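/- **Conventions.** Let $f:\mathbb R^p\to\mathbb R^q$ and let $U\subset\mathbb R^p$ be open. A set-valued map $J:\mathbb{R}^p\rightrightarrows\mathbb R^{q\times p}$ is a *conservative Jacobian of $f$ on $U$* if $f$ is locally Lipschitz on $U$, $J$ is nonempty-valued and locally bounded on $U$ with graph closed in $U\times\mathbb R^{q\times p}$, and for every absolutely continuous curve $\gamma:\mathbb R\to U$ and almost every $t$ one has $\frac{d}{dt}f(\gamma(t))=M\dot\gamma(t)$ for all $M\in J(\gamma(t))$. The map $f$ is *path differentiable on $U$* if it has a conservative Jacobian on $U$; if $U$ is not mentioned, it is the whole space. **Setting.** Let $\mathcal K\subset\mathbb R^m$ be a nonempty closed convex cone, $\mathcal K^*$ its dual cone, $P_{\mathcal K^*}$ the Euclidean projection onto $\mathcal{K}^*$, and $N=n+m$. For $A\in\mathbb R^{m\times n}$, $b\in\mathbb R^m$, $c\in\mathbb R^n$ consider $$\text{(P)}\ \inf\{c^Tx : Ax+s=b,\ s\in\mathcal K\},\qquad \text{(D)}\ \inf\{b^Ty : A^Ty+c=0,\ y\in\mathcal K^*\}.$$ For $z=(u,v)\in\mathbb R^n\times\mathbb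 R^m$ put $\Pi z=(u,P_{\mathcal K^*}(v))$ (the projection onto $\mathbb R^n\times\mathcal K^*$), $$\mathcal N(z,A,b,c)=\left(\begin{bmatrix}0&A^T\\-A&0\end{bmatrix}-\mathrm{Id}_N\right)\Pi z+\begin{bmatrix}c\\b\end{bmatrix}+z,\qquad \phi(u,v)=(u,P_{\mathcal K^*}(v),P_{\mathcal K^*}(v)-v).$$ **Proposition.** Assume that $P_{\mathcal K^*}$ and $\mathcal N$ are path differentiable, with convex-valued conservative Jacobians $J_{P_{\mathcal K^*}}$ and $J_{\mathcal N}$. Let $\mathcal W\subset\mathbb R^{m\times n}\times\mathbb R^m\times\mathbb R^n$ be an open set of parameters (possibly the whole space) such that, for every $(A,b,c)\in\mathcal W$, the equation $\mathcal N(z,A,b,c)=0$ has a unique solution $z=\nu(A,b,c)\in\mathbb R^N$, and, for every $[U\ V]\in J_{\mathcal N}(\nu(A,b,c),A,b,c)$, the matrix $U\in\mathbb R^{N\times N}$ of the first $N$ columns (those of the variable $z$) is invertible. Then for every $(A,b,c)\in\mathcal W$ there is exactly one triple $(x,y,s)=:\mathrm{sol}(A,b,c)$ such that $(x,s)$ solves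 (P) and $y$ solves (D), and $\mathrm{sol}=\phi\circ\nu$ on $\mathcal W$. Moreover $\phi$ is path differentiable on $\mathbb R^N$, $\nu$ and $\mathrm{sol}$ are path differentiable on $\mathcal W$, and they have there the conservative Jacobians $$J_\nu(A,b,c)=\{-U^{-1}V : [U\ V]\in J_{\mathcal N}(\nu(A,b,c),A,b,c)\},$$ $$J_\phi(u,v)=\begin{bmatrix}\mathrm{Id}_n&0\\0&J_{P_{\mathcal K^*}}(v)\\0&J_{P_{\mathcal K^*}}(v)-\mathrm{Id}_m\end{bmatrix},\qquad J_{\mathrm{sol}}(A,b,c)=J_\phi(\nu(A,b,c))\,J_\nu(A,b,c),$$ where the last expression is the set of all products. This holds both when the two occurrences of $J_{P_{\mathcal K^*}}(v)$ in $J_\phi$ stand for the same matrix $M\in J_{P_{\mathcal K^*}}(v)$ and when they stand for two independently chosen matrices $M,M'\in J_{P_{\mathcal K^*}}(v)$. -/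

import Mathlib

open Set Filter Topology MeasureTheory
open scoped Matrix InnerProductSpace

attribute [local instance] Matrix.normedAddCommGroup Matrix.normedSpace

/-! ### Conservative Jacobians -/

section Conservative

variable {E F : Type*} [NormedAddCommGroup E] [NormedSpace ℝ E]
  [NormedAddCommGroup F] [NormedSpace ℝ F]

/-- An absolutely continuous curve `ℝ → E`: it is continuous, differentiable almost everywhere,
and it is the integral of its (locally integrable) derivative. -/
structure IsAbsolutelyContinuousCurve (γ : ℝ → E) : Prop where
  continuous : Continuous γ
  ae_differentiableAt : ∀ᵐ t : ℝ, DifferentiableAt ℝ γ t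
  intervalIntegrable : ∀ a b : ℝ, IntervalIntegrable (deriv γ) volume a b
  eq_integral : ∀ t : ℝ, γ t - γ 0 = ∫ τ in (0 : ℝ)..t, deriv γ τ

/-- `J` is a conservative Jacobian of `f` on the (open) set `U`: `f` is locally Lipschitz on `U`,
`J` is nonempty-valued, has a closed graph in `U × (E →L[ℝ] F)`, is locally bounded, and along
every absolutely continuous curve `γ` in `U`, for almost every `t`, the derivative of `f ∘ γ` at
`t` exists and equals `A γ'(t)` for all `A ∈ J (γ t)`. Jacobian matrices are represented by
the linear maps they define. -/
structure IsConservativeJacobianOn (U : Set E) (f : E → F) (J : E → Set (E →L[ℝ] F)) : Prop where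
  locallyLipschitzOn : LocallyLipschitzOn U f
  nonempty : ∀ x ∈ U, (J x).Nonempty
  isClosed_graph : IsClosed {p : U × (E →L[ℝ] F) | p.2 ∈ J p.1}
  locallyBounded : ∀ x ∈ U, ∃ M : ℝ, ∀ᶠ u in 𝓝[U] x, ∀ A ∈ J u, ‖A‖ < M
  chain_rule : ∀ γ : ℝ → E, IsAbsolutelyContinuousCurve γ → (∀ t, γ t ∈ U) →
    ∀ᵐ t : ℝ, ∀ A ∈ J (γ t), HasDerivAt (f ∘ γ) (A (deriv γ t)) t

/-- `f` is path differentiable on `U`: it is locally Lipschitz there and has a conservative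
Jacobian. -/
def PathDifferentiableOn (U : Set E) (f : E → F) : Prop :=
  ∃ J : E → Set (E →L[ℝ] F), IsConservativeJacobianOn U f J

end Conservative

/-! ### Projections onto closed convex sets -/

section Projection

variable {E : Type*} [NormedAddCommGroup E]

/-- `p` is a nearest point to `x` in `C`. -/
def IsNearestPoint (C : Set E) (x p : E) : Prop :=
  p ∈ C ∧ ∀ q ∈ C, ‖p - x‖ ≤ ‖q - x‖

/-- The projection of `x` onto `C` (a nearest point; for a nonempty closed convex subset of a
Euclidean space it exists and is unique, see below). -/
noncomputable def metricProj (C : Set E) (x : E) : E :=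
  Classical.epsilon (IsNearestPoint C x)

variable [InnerProductSpace ℝ E]

theorem IsNearestPoint.eq_of_convex {C : Set E} (hC : Convex ℝ C) {x p q : E}
    (hp : IsNearestPoint C x p) (hq : IsNearestPoint C x q) : p = q := by
  have hpq : ‖p - x‖ = ‖q - x‖ := le_antisymm (hp.2 q hq.1) (hq.2 p hp.1)
  have hmid : (1 / 2 : ℝ) • p + (1 / 2 : ℝ) • q ∈ C :=
    hC hp.1 hq.1 (by norm_num) (by norm_num) (by norm_num)
  have h1 := hp.2 _ hmid
  have e : (1 / 2 : ℝ) • p + (1 / 2 : ℝ) • q - x = (1 / 2 : ℝ) • ((p - x) + (q - x)) := by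
    module
  rw [e, norm_smul] at h1
  have h2 := parallelogram_law_with_norm ℝ (p - x) (q - x)
  have h3 : ‖(p - x) - (q - x)‖ = ‖p - q‖ := by congr 1; abel
  rw [h3, ← hpq] at h2
  have h4 : 2 * ‖p - x‖ ≤ ‖(p - x) + (q - x)‖ := by
    norm_num at h1; linarith
  have h5 : ‖p - q‖ * ‖p - q‖ ≤ 0 := by
    nlinarith [norm_nonneg (p - x), norm_nonneg ((p - x) + (q - x))]
  have h6 : ‖p - q‖ = 0 := by nlinarith [norm_nonneg (p - q)]
  exact sub_eq_zero.mp (norm_eq_zero.mp h6)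

theorem exists_isNearestPoint [CompleteSpace E] {C : Set E} (hne : C.Nonempty)
    (hcl : IsClosed C) (hC : Convex ℝ C) (x : E) : ∃ p, IsNearestPoint C x p := by
  obtain ⟨p, hp, h⟩ := exists_norm_eq_iInf_of_complete_convex hne hcl.isComplete hC x
  refine ⟨p, hp, fun q hq => ?_⟩
  rw [norm_sub_rev p x, norm_sub_rev q x, h]
  exact ciInf_le ⟨0, by rintro _ ⟨y, rfl⟩; exact norm_nonneg _⟩ (⟨q, hq⟩ : C)

theorem isNearestPoint_metricProj [CompleteSpace E] {C : Set E} (hne : C.Nonempty)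
    (hcl : IsClosed C) (hC : Convex ℝ C) (x : E) : IsNearestPoint C x (metricProj C x) :=
  Classical.epsilon_spec (exists_isNearestPoint hne hcl hC x)

end Projection

/-! ### Cone programs -/

namespace ConeProgram

/-- `ℝᵏ` with its Euclidean structure. -/
abbrev Euc (k : ℕ) : Type := EuclideanSpace ℝ (Fin k)

/-- The space `ℝⁿ × ℝᵐ = ℝᴺ` of the variable `z = (u, v)`. -/
abbrev Var (n m : ℕ) : Type := Euc n × Euc m

/-- The space `ℝᵐˣⁿ × ℝᵐ × ℝⁿ` of the parameters `(A, b, c)`. -/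
abbrev Param (n m : ℕ) : Type := Matrix (Fin m) (Fin n) ℝ × Euc m × Euc n

/-- The space `ℝⁿ × ℝᵐ × ℝᵐ` of the triples `(x, y, s)`. -/
abbrev Sol (n m : ℕ) : Type := Euc n × Euc m × Euc m

variable {n m : ℕ}

/-- Matrix-vector product between Euclidean spaces. -/
def mulVecE {k l : ℕ} (A : Matrix (Fin k) (Fin l) ℝ) (x : Euc l) : Euc k :=
  WithLp.toLp 2 (A *ᵥ x.ofLp)

/-- The dual cone `K* = {y | ⟪x, y⟫ ≥ 0 for all x ∈ K}`. -/
noncomputable def dualCone (K : ProperCone ℝ (Euc m)) : ProperCone ℝ (Euc m) :=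
  ProperCone.innerDual (K : Set (Euc m))

/-- The projection `P_{K*}` onto the dual cone. -/
noncomputable def projDual (K : ProperCone ℝ (Euc m)) (v : Euc m) : Euc m :=
  metricProj (dualCone K : Set (Euc m)) v

/-- The projection `Π` onto `ℝⁿ × K*`. -/
noncomputable def projPi (K : ProperCone ℝ (Euc m)) (z : Var n m) : Var n m :=
  (z.1, projDual K z.2)

theorem convex_dualCone (K : ProperCone ℝ (Euc m)) :
    Convex ℝ (dualCone K : Set (Euc m)) := by
  intro x hx y hy a b ha hb _
  exact add_mem ((dualCone K).smul_mem hx ha)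
    ((dualCone K).smul_mem hy hb)

theorem isNearestPoint_projDual (K : ProperCone ℝ (Euc m)) (v : Euc m) :
    IsNearestPoint (dualCone K : Set (Euc m)) v (projDual K v) :=
  isNearestPoint_metricProj ⟨0, (dualCone K).zero_mem⟩ (dualCone K).isClosed
    (convex_dualCone K) v

/-- `projPi` is the Euclidean projection onto `ℝⁿ × K*`. -/
theorem toLp_projPi (K : ProperCone ℝ (Euc m)) (z : Var n m) :
    WithLp.toLp 2 (projPi K z) =
      metricProj {w : WithLp 2 (Var n m) | w.snd ∈ dualCone K} (WithLp.toLp 2 z) := by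
  have hnear : IsNearestPoint {w : WithLp 2 (Var n m) | w.snd ∈ dualCone K}
      (WithLp.toLp 2 z) (WithLp.toLp 2 (projPi K z)) := by
    refine ⟨(isNearestPoint_projDual K z.2).1, fun q hq => ?_⟩
    rw [WithLp.prod_norm_eq_of_L2, WithLp.prod_norm_eq_of_L2]
    apply Real.sqrt_le_sqrt
    have h := (isNearestPoint_projDual K z.2).2 q.snd hq
    have h0 : ‖projDual K z.2 - z.2‖ ^ 2 ≤ ‖q.snd - z.2‖ ^ 2 := by gcongr
    have e : ‖z.1 - z.1‖ ^ 2 = 0 := by simp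
    change ‖z.1 - z.1‖ ^ 2 + ‖projDual K z.2 - z.2‖ ^ 2 ≤
      ‖q.fst - z.1‖ ^ 2 + ‖q.snd - z.2‖ ^ 2
    nlinarith [sq_nonneg ‖q.fst - z.1‖]
  refine hnear.eq_of_convex ?_ (Classical.epsilon_spec ⟨_, hnear⟩)
  intro x hx y hy a b ha hb hab
  exact convex_dualCone K hx hy ha hb hab

/-- The action on `(u, v)` of the matrix `Q(A, b, c) = [0, Aᵀ; -A, 0]`. -/
def skewQ (w : Param n m) (z : Var n m) : Var n m :=
  (mulVecE w.1ᵀ z.2, -mulVecE w.1 z.1)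

/-- The vector `V(b, c) = (c, b)`. -/
def vecV (w : Param n m) : Var n m := (w.2.2, w.2.1)

/-- The residual map `𝒩(z, A, b, c) = (Q(A, b, c) - Id) Π z + V(b, c) + z`. -/
noncomputable def residualMap (K : ProperCone ℝ (Euc m)) (p : Var n m × Param n m) : Var n m :=
  (skewQ p.2 (projPi K p.1) - projPi K p.1) + vecV p.2 + p.1

/-- The map `φ(u, v) = (u, P_{K*}(v), P_{K*}(v) - v)`. -/
noncomputable def phi (K : ProperCone ℝ (Euc m)) (z : Var n m) : Sol n m :=
  (z.1, projDual K z.2, projDual K z.2 - z.2)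

/-- `(x, s)` is feasible for (P): `A x + s = b`, `s ∈ K`. -/
def PrimalFeasible (K : ProperCone ℝ (Euc m)) (w : Param n m) (x : Euc n) (s : Euc m) : Prop :=
  mulVecE w.1 x + s = w.2.1 ∧ s ∈ K

/-- `y` is feasible for (D): `Aᵀ y + c = 0`, `y ∈ K*`. -/
def DualFeasible (K : ProperCone ℝ (Euc m)) (w : Param n m) (y : Euc m) : Prop :=
  mulVecE w.1ᵀ y + w.2.2 = 0 ∧ y ∈ dualCone K

/-- `t = (x, y, s)` is a primal-dual solution: `(x, s)` minimizes `cᵀ x` over the feasible points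
of (P) and `y` minimizes `bᵀ y` over the feasible points of (D). -/
def IsPrimalDualSolution (K : ProperCone ℝ (Euc m)) (w : Param n m) (t : Sol n m) : Prop :=
  (PrimalFeasible K w t.1 t.2.2 ∧
    ∀ x s, PrimalFeasible K w x s → ⟪w.2.2, t.1⟫_ℝ ≤ ⟪w.2.2, x⟫_ℝ) ∧
  (DualFeasible K w t.2.1 ∧
    ∀ y, DualFeasible K w y → ⟪w.2.1, t.2.1⟫_ℝ ≤ ⟪w.2.1, y⟫_ℝ)

/-- The block `U` of `[U V]`: the columns of the variable `z`. -/
def blockU (B : Var n m × Param n m →L[ℝ] Var n m) : Var n m →L[ℝ] Var n m :=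
  B.comp (ContinuousLinearMap.inl ℝ (Var n m) (Param n m))

/-- The block `V` of `[U V]`: the columns of the parameters `(A, b, c)`. -/
def blockV (B : Var n m × Param n m →L[ℝ] Var n m) : Param n m →L[ℝ] Var n m :=
  B.comp (ContinuousLinearMap.inr ℝ (Var n m) (Param n m))

/-- `J_ν(w) = {-U⁻¹ V : [U V] ∈ J_𝒩(ν(w), w)}`. -/
noncomputable def jacNu
    (JN : Var n m × Param n m → Set (Var n m × Param n m →L[ℝ] Var n m))
    (ν : Param n m → Var n m) (w : Param n m) : Set (Param n m →L[ℝ] Var n m) :=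
  {L | ∃ B ∈ JN (ν w, w), L = -((blockU B).inverse.comp (blockV B))}

/-- The block matrix `[Id, 0; 0, M; 0, M' - Id]`. -/
def blockPhi (M M' : Euc m →L[ℝ] Euc m) : Var n m →L[ℝ] Sol n m :=
  (ContinuousLinearMap.fst ℝ (Euc n) (Euc m)).prod
    ((M.comp (ContinuousLinearMap.snd ℝ (Euc n) (Euc m))).prod
      ((M' - ContinuousLinearMap.id ℝ (Euc m)).comp
        (ContinuousLinearMap.snd ℝ (Euc n) (Euc m))))

/-- `J_φ(u, v) = [Id, 0; 0, J_P(v); 0, J_P(v) - Id]`, the two blocks being chosen independently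
in `J_P(v)`. -/
def jacPhi (JP : Euc m → Set (Euc m →L[ℝ] Euc m)) (z : Var n m) :
    Set (Var n m →L[ℝ] Sol n m) :=
  {L | ∃ M ∈ JP z.2, ∃ M' ∈ JP z.2, L = blockPhi M M'}

/-- `J_φ(u, v) = [Id, 0; 0, J_P(v); 0, J_P(v) - Id]`, with the same element of `J_P(v)` in the
two blocks. -/
def jacPhiSame (JP : Euc m → Set (Euc m →L[ℝ] Euc m)) (z : Var n m) :
    Set (Var n m →L[ℝ] Sol n m) :=
  {L | ∃ M ∈ JP z.2, L = blockPhi M M}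

/-- The product of sets of matrices `J_φ(ν(w)) J_ν(w)`. -/
def jacComp (Jφ : Var n m → Set (Var n m →L[ℝ] Sol n m))
    (ν : Param n m → Var n m) (Jν : Param n m → Set (Param n m →L[ℝ] Var n m))
    (w : Param n m) : Set (Param n m →L[ℝ] Sol n m) :=
  {L | ∃ S ∈ Jφ (ν w), ∃ T ∈ Jν w, L = S.comp T}

/-- The solution map `sol = φ ∘ ν`. -/
noncomputable def sol (K : ProperCone ℝ (Euc m)) (ν : Param n m → Var n m) :
    Param n m → Sol n m :=
  phi K ∘ ν

end ConeProgram

open ConeProgram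

/-! Optimality. By Moreau's decomposition, `v = y - s` with `y = P_{K*}(v)` and `s = P_{K*}(v) - v`
in `K` orthogonal to `y`. Under this substitution the zeros of the residual map become the feasible
triples with `⟪s, y⟫ = 0`. For feasible triples, `⟪c, x⟫ + ⟪b, y⟫ = ⟪s, y⟫ ≥ 0`, so the triple
`φ(ν(w))`, which has zero gap, is optimal. Any other optimal triple also has zero gap, hence comes
from a zero of the residual map, and that zero is unique.

Regularity. The core is an implicit function theorem, `IsConservativeJacobianOn.implicit`. Convexity
of the Jacobian gives a mean value estimate: near a point `p₀`, increments of the map are, up to a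
small relative error, those of a single element of `J p₀`. If `‖N(·, w)‖` (in a Euclidean norm) has
an interior minimum at a point where all the blocks `U` are invertible, this estimate and a
separation argument force the minimum to be zero. Global uniqueness of zeros then makes `ν`
continuous. The mean value estimate, with a uniform bound on the inverses `U⁻¹`, makes `ν` locally
Lipschitz. Finally, differentiating `N(ν(γ), γ) = 0` along a curve gives `U (ν ∘ γ)' + V γ' = 0`,
the chain rule for `-U⁻¹V`.

The Jacobian of `sol` follows from the chain rule for compositions. Closed graphs and local bounds
are handled together, as compact-valued upper semicontinuity (`IsUsco`). -/

/-! ### Absolutely continuous curves -/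

section AbsolutelyContinuous

variable {E F G : Type*} [NormedAddCommGroup E] [NormedSpace ℝ E]
  [NormedAddCommGroup F] [NormedSpace ℝ F] [NormedAddCommGroup G] [NormedSpace ℝ G]

theorem AbsolutelyContinuousOnInterval.of_dist_le {X Y : Type*} [PseudoMetricSpace X]
    [PseudoMetricSpace Y] {f : ℝ → X} {g : ℝ → Y} {a b C : ℝ}
    (hg : AbsolutelyContinuousOnInterval g a b)
    (h : ∀ s ∈ uIcc a b, ∀ t ∈ uIcc a b, dist (f s) (f t) ≤ C * dist (g s) (g t)) :
    AbsolutelyContinuousOnInterval f a b := by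
  have hg' := Tendsto.const_mul C hg
  rw [mul_zero] at hg'
  refine tendsto_of_tendsto_of_tendsto_of_le_of_le' tendsto_const_nhds hg'
    (Eventually.of_forall fun _ => Finset.sum_nonneg fun _ _ => dist_nonneg) ?_
  refine Filter.eventually_inf_principal.2 (Eventually.of_forall fun I hI => ?_)
  rw [Finset.mul_sum]
  exact Finset.sum_le_sum fun i hi => h _ (hI.1 i hi).1 _ (hI.1 i hi).2

theorem IsAbsolutelyContinuousCurve.absolutelyContinuousOnInterval {γ : ℝ → E}
    (h : IsAbsolutelyContinuousCurve γ) (a b : ℝ) : AbsolutelyContinuousOnInterval γ a b := by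
  have hn : IntervalIntegrable (fun t => ‖deriv γ t‖) volume a b :=
    (h.intervalIntegrable a b).norm
  -- The increments of `γ` are dominated by those of the primitive of `‖γ'‖`.
  have hg := hn.absolutelyContinuousOnInterval_intervalIntegral (c := a) (by simp)
  refine hg.of_dist_le (C := 1) fun s _ t _ => ?_
  have e : ∀ s t, γ s - γ t = ∫ τ in t..s, deriv γ τ := by
    intro s t
    rw [← sub_sub_sub_cancel_right _ _ (γ 0), h.eq_integral, h.eq_integral,
      intervalIntegral.integral_interval_sub_left (h.intervalIntegrable _ _)
        (h.intervalIntegrable _ _)]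
  rw [one_mul, dist_eq_norm, e, Real.dist_eq, intervalIntegral.integral_interval_sub_left
    (h.intervalIntegrable _ _).norm (h.intervalIntegrable _ _).norm]
  exact intervalIntegral.norm_integral_le_abs_integral_norm

theorem isAbsolutelyContinuousCurve_real {γ : ℝ → ℝ}
    (h : ∀ a b, AbsolutelyContinuousOnInterval γ a b) : IsAbsolutelyContinuousCurve γ where
  continuous := by
    refine continuous_iff_continuousAt.2 fun t => ?_
    refine (h (t - 1) (t + 1)).continuousOn.continuousAt ?_
    rw [uIcc_of_le (by linarith)]
    exact Icc_mem_nhds (by linarith) (by linarith)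
  ae_differentiableAt := by
    have : ∀ᵐ t : ℝ, ∀ k : ℕ, t ∈ uIcc (-k : ℝ) k → DifferentiableAt ℝ γ t :=
      ae_all_iff.2 fun k => (h _ _).ae_differentiableAt
    filter_upwards [this] with t ht
    obtain ⟨k, hk⟩ := exists_nat_ge |t|
    refine ht k ?_
    rw [uIcc_of_le (by linarith [abs_nonneg t])]
    exact abs_le.1 hk
  intervalIntegrable a b := (h a b).intervalIntegrable_deriv
  eq_integral t := (h 0 t).integral_deriv_eq_sub.symm

theorem isAbsolutelyContinuousCurve_pi {ι : Type*} [Fintype ι] {γ : ℝ → ι → ℝ}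
    (h : ∀ i, IsAbsolutelyContinuousCurve fun t => γ t i) : IsAbsolutelyContinuousCurve γ := by
  have hd : ∀ᵐ t : ℝ, ∀ i, DifferentiableAt ℝ (fun t => γ t i) t :=
    ae_all_iff.2 fun i => (h i).ae_differentiableAt
  have hderiv : ∀ᵐ t : ℝ, (fun i => deriv (fun t => γ t i) t) = deriv γ t := by
    filter_upwards [hd] with t ht
    exact (deriv_pi ht).symm
  have hint : ∀ a b, IntervalIntegrable (deriv γ) volume a b := by
    intro a b
    have : IntervalIntegrable (fun t i => deriv (fun t => γ t i) t) volume a b :=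
      ⟨Integrable.of_eval fun i => ((h i).intervalIntegrable a b).1,
        Integrable.of_eval fun i => ((h i).intervalIntegrable a b).2⟩
    exact this.congr_ae (ae_restrict_of_ae hderiv)
  refine ⟨continuous_pi fun i => (h i).continuous, ?_, hint, fun t => ?_⟩
  · filter_upwards [hd] with t ht
    exact differentiableAt_pi.2 ht
  · funext i
    have e := ContinuousLinearMap.intervalIntegral_comp_comm
      (ContinuousLinearMap.proj (R := ℝ) (φ := fun _ : ι => ℝ) i) (hint 0 t)
    have e' := (h i).eq_integral t
    rw [Pi.sub_apply, e']
    refine Eq.trans ?_ e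
    refine intervalIntegral.integral_congr_ae ?_
    filter_upwards [hderiv] with t ht _
    rw [← ht]
    rfl

theorem IsAbsolutelyContinuousCurve.clm_comp [CompleteSpace E] [CompleteSpace F] {γ : ℝ → E}
    (h : IsAbsolutelyContinuousCurve γ)
    (L : E →L[ℝ] F) : IsAbsolutelyContinuousCurve fun t => L (γ t) := by
  have hderiv : ∀ᵐ t : ℝ, L (deriv γ t) = deriv (fun t => L (γ t)) t := by
    filter_upwards [h.ae_differentiableAt] with t ht
    exact ((L.hasFDerivAt.comp_hasDerivAt t ht.hasDerivAt).deriv).symm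
  have hint : ∀ a b, IntervalIntegrable (fun t => L (deriv γ t)) volume a b := fun a b =>
    ⟨L.integrable_comp (h.intervalIntegrable a b).1, L.integrable_comp (h.intervalIntegrable a b).2⟩
  refine ⟨L.continuous.comp h.continuous, ?_,
    fun a b => (hint a b).congr_ae (ae_restrict_of_ae hderiv), fun t => ?_⟩
  · filter_upwards [h.ae_differentiableAt] with t ht
    exact L.differentiableAt.comp t ht
  · rw [← map_sub, h.eq_integral, ← L.intervalIntegral_comp_comm (h.intervalIntegrable _ _)]
    refine intervalIntegral.integral_congr_ae ?_
    filter_upwards [hderiv] with t ht _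
    exact ht

/-- The ε-δ form involves only distances, so it passes through Lipschitz maps. Conversely,
real-valued functions satisfying it are integrals of their derivatives; coordinates reduce the
finite-dimensional case to this one. -/
theorem isAbsolutelyContinuousCurve_iff [FiniteDimensional ℝ E] {γ : ℝ → E} :
    IsAbsolutelyContinuousCurve γ ↔ ∀ a b, AbsolutelyContinuousOnInterval γ a b := by
  refine ⟨fun h => h.absolutelyContinuousOnInterval, fun h => ?_⟩
  have : CompleteSpace E := FiniteDimensional.complete ℝ E
  let e := (Module.finBasis ℝ E).equivFunL
  have h1 : IsAbsolutelyContinuousCurve fun t => e (γ t) := by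
    refine isAbsolutelyContinuousCurve_pi fun i => isAbsolutelyContinuousCurve_real fun a b => ?_
    let L : E →L[ℝ] ℝ := (ContinuousLinearMap.proj (R := ℝ) (φ := fun _ => ℝ) i).comp (e : E →L[ℝ] _)
    refine (h a b).of_dist_le (C := ‖L‖) fun s _ t _ => ?_
    rw [dist_eq_norm, dist_eq_norm]
    have := L.le_opNorm (γ s - γ t)
    rwa [map_sub] at this
  have h2 := h1.clm_comp (e.symm : _ →L[ℝ] E)
  simpa using h2

/-- A compact time interval has compact image under `γ`, on which a locally Lipschitz map is
Lipschitz. -/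
theorem IsAbsolutelyContinuousCurve.locallyLipschitzOn_comp [FiniteDimensional ℝ F]
    {U : Set E} {f : E → F} (hf : LocallyLipschitzOn U f) {γ : ℝ → E}
    (h : IsAbsolutelyContinuousCurve γ) (hγ : ∀ t, γ t ∈ U) :
    IsAbsolutelyContinuousCurve (f ∘ γ) := by
  refine isAbsolutelyContinuousCurve_iff.2 fun a b => ?_
  have hc : IsCompact (γ '' uIcc a b) := isCompact_uIcc.image h.continuous
  obtain ⟨C, hC⟩ := (hf.mono (by rintro _ ⟨t, _, rfl⟩; exact hγ t)).exists_lipschitzOnWith_of_compact hc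
  refine (h.absolutelyContinuousOnInterval a b).of_dist_le (C := C) fun s hs t ht => ?_
  exact hC.dist_le_mul _ (mem_image_of_mem _ hs) _ (mem_image_of_mem _ ht)

theorem IsAbsolutelyContinuousCurve.prodMk [FiniteDimensional ℝ E] [FiniteDimensional ℝ F]
    {γ : ℝ → E} {δ : ℝ → F} (h : IsAbsolutelyContinuousCurve γ)
    (h' : IsAbsolutelyContinuousCurve δ) : IsAbsolutelyContinuousCurve fun t => (γ t, δ t) := by
  have : CompleteSpace E := FiniteDimensional.complete ℝ E
  have : CompleteSpace F := FiniteDimensional.complete ℝ F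
  have h1 := h.clm_comp (ContinuousLinearMap.inl ℝ E F)
  have h2 := h'.clm_comp (ContinuousLinearMap.inr ℝ E F)
  refine isAbsolutelyContinuousCurve_iff.2 fun a b => ?_
  have := (h1.absolutelyContinuousOnInterval a b).fun_add (h2.absolutelyContinuousOnInterval a b)
  simpa using this

theorem isAbsolutelyContinuousCurve_line [FiniteDimensional ℝ E] (p d : E) :
    IsAbsolutelyContinuousCurve fun t : ℝ => p + t • d := by
  refine isAbsolutelyContinuousCurve_iff.2 fun a b => ?_
  refine LipschitzOnWith.absolutelyContinuousOnInterval (K := ‖d‖₊) ?_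
  refine LipschitzWith.lipschitzOnWith (LipschitzWith.of_dist_le_mul fun s t => ?_)
  rw [dist_add_left, dist_eq_norm, ← sub_smul, norm_smul, mul_comm, Real.dist_eq, Real.norm_eq_abs]
  rfl

end AbsolutelyContinuous

/-! ### Compact-valued upper semicontinuous maps -/

section Usco

variable {X X' Y Z : Type*} [TopologicalSpace X] [TopologicalSpace X'] [TopologicalSpace Y]
  [TopologicalSpace Z]

/-- A set-valued map which is compact-valued and upper semicontinuous. -/
structure IsUsco (J : X → Set Y) : Prop where
  isCompact : ∀ x, IsCompact (J x)
  eventually_subset : ∀ x, ∀ O, IsOpen O → J x ⊆ O → ∀ᶠ u in 𝓝 x, J u ⊆ O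

theorem IsUsco.comp {J : X → Set Y} (hJ : IsUsco J) {g : X' → X} (hg : Continuous g) :
    IsUsco fun x => J (g x) where
  isCompact x := hJ.isCompact (g x)
  eventually_subset x O hO h := hg.continuousAt.eventually (hJ.eventually_subset (g x) O hO h)

theorem IsUsco.prod {J : X → Set Y} (hJ : IsUsco J) {J' : X → Set Z} (hJ' : IsUsco J') :
    IsUsco fun x => J x ×ˢ J' x where
  isCompact x := (hJ.isCompact x).prod (hJ'.isCompact x)
  eventually_subset x O hO h := by
    obtain ⟨u, v, hu, hv, hJu, hJv, huv⟩ :=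
      generalized_tube_lemma (hJ.isCompact x) (hJ'.isCompact x) hO h
    filter_upwards [hJ.eventually_subset x u hu hJu, hJ'.eventually_subset x v hv hJv]
      with y h1 h2
    exact (prod_mono h1 h2).trans huv

/-- Continuity of `g` is required only at points of the graph of `J`. This matters for inversion of
linear maps, which is applied where the blocks are invertible. -/
theorem IsUsco.image {J : X → Set Y} (hJ : IsUsco J) {g : X × Y → Z}
    (hg : ∀ x, ∀ A ∈ J x, ContinuousAt g (x, A)) : IsUsco fun x => (fun A => g (x, A)) '' J x where
  isCompact x := (hJ.isCompact x).image_of_continuousOn fun A hA =>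
    ((hg x A hA).comp (f := fun A => (x, A)) (by fun_prop)).continuousWithinAt
  eventually_subset x O hO h := by
    have hsub : {x} ×ˢ J x ⊆ interior (g ⁻¹' O) := by
      rintro ⟨y, A⟩ ⟨rfl, hA⟩
      exact mem_interior_iff_mem_nhds.2 ((hg y A hA) (hO.mem_nhds (h ⟨A, hA, rfl⟩)))
    obtain ⟨u, v, hu, hv, hxu, hJv, huv⟩ :=
      generalized_tube_lemma isCompact_singleton (hJ.isCompact x) isOpen_interior hsub
    filter_upwards [hJ.eventually_subset x v hv hJv, hu.mem_nhds (hxu rfl)] with y h1 h2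
    rintro _ ⟨A, hA, rfl⟩
    exact interior_subset (s := g ⁻¹' O) (huv ⟨h2, h1 hA⟩)

theorem IsUsco.isClosed_graph [T2Space Y] {J : X → Set Y} (hJ : IsUsco J) :
    IsClosed {p : X × Y | p.2 ∈ J p.1} := by
  refine isOpen_compl_iff.1 (isOpen_iff_mem_nhds.2 ?_)
  rintro ⟨x, A⟩ (hA : A ∉ J x)
  obtain ⟨u, v, hu, hv, hJu, hAv, huv⟩ := (hJ.isCompact x).separation_of_notMem hA
  refine mem_of_superset (prod_mem_nhds (hJ.eventually_subset x u hu hJu) (hv.mem_nhds hAv)) ?_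
  rintro ⟨y, B⟩ ⟨hy, hB⟩ hBy
  exact disjoint_left.1 huv (hy hBy) hB

theorem IsUsco.locallyBounded {Y : Type*} [NormedAddCommGroup Y] {J : X → Set Y}
    (hJ : IsUsco J) (x : X) : ∃ M : ℝ, ∀ᶠ u in 𝓝 x, ∀ A ∈ J u, ‖A‖ < M := by
  obtain ⟨M, hM⟩ := (hJ.isCompact x).isBounded.exists_norm_le
  refine ⟨M + 1, ?_⟩
  have := hJ.eventually_subset x (Metric.ball 0 (M + 1)) Metric.isOpen_ball fun A hA => by
    rw [mem_ball_zero_iff]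
    linarith [hM A hA]
  filter_upwards [this] with u hu A hA
  exact mem_ball_zero_iff.1 (hu hA)

/-- Near `x` all values lie in one closed ball, and the part of this ball outside `O` is compact.
Each of its points avoids nearby values because the graph is closed, and compactness makes the
neighbourhood of `x` uniform. -/
theorem isUsco_of_isClosed_graph {Y : Type*} [NormedAddCommGroup Y] [ProperSpace Y]
    {J : X → Set Y} (hc : IsClosed {p : X × Y | p.2 ∈ J p.1})
    (hb : ∀ x, ∃ M : ℝ, ∀ᶠ u in 𝓝 x, ∀ A ∈ J u, ‖A‖ < M) : IsUsco J where
  isCompact x := by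
    obtain ⟨M, hM⟩ := hb x
    have hcl : IsClosed (J x) := hc.preimage (f := fun A => (x, A)) (by fun_prop)
    refine (isCompact_closedBall (0 : Y) M).of_isClosed_subset hcl fun A hA => ?_
    exact mem_closedBall_zero_iff.2 (hM.self_of_nhds A hA).le
  eventually_subset x O hO h := by
    obtain ⟨M, hM⟩ := hb x
    have hC : IsCompact (Metric.closedBall (0 : Y) M \ O) :=
      (isCompact_closedBall (0 : Y) M).diff hO
    have key : ∀ A ∈ Metric.closedBall (0 : Y) M \ O,
        ∀ᶠ p : X × Y in 𝓝 x ×ˢ 𝓝 A, p.2 ∉ J p.1 := by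
      intro A hA
      rw [← nhds_prod_eq]
      exact hc.isOpen_compl.mem_nhds fun hA' => hA.2 (h hA')
    have := hC.eventually_forall_of_forall_eventually (x₀ := x) (P := fun u A => A ∉ J u)
      fun A hA => by rw [nhds_prod_eq]; exact key A hA
    filter_upwards [this, hM] with u h1 h2 A hA
    by_contra hAO
    exact h1 A ⟨mem_closedBall_zero_iff.2 (h2 A hA).le, hAO⟩ hA

end Usco

/-! ### Calculus of conservative Jacobians -/

section ConservativeJacobian

variable {E F G : Type*} [NormedAddCommGroup E] [NormedSpace ℝ E]
  [NormedAddCommGroup F] [NormedSpace ℝ F] [NormedAddCommGroup G] [NormedSpace ℝ G]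

theorem eventually_nhds_subtype_iff_nhdsWithin {X : Type*} [TopologicalSpace X] {U : Set X}
    (x : U) (p : X → Prop) : (∀ᶠ u : U in 𝓝 x, p u) ↔ ∀ᶠ u in 𝓝[U] (x : X), p u := by
  rw [← map_nhds_subtype_val, eventually_map]

theorem IsConservativeJacobianOn.isUsco [FiniteDimensional ℝ E] [FiniteDimensional ℝ F]
    {U : Set E} {f : E → F} {J : E → Set (E →L[ℝ] F)}
    (h : IsConservativeJacobianOn U f J) : IsUsco fun x : U => J x := by
  have : ProperSpace (E →L[ℝ] F) := FiniteDimensional.proper ℝ _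
  refine isUsco_of_isClosed_graph h.isClosed_graph fun x => ?_
  obtain ⟨M, hM⟩ := h.locallyBounded x x.2
  exact ⟨M, (eventually_nhds_subtype_iff_nhdsWithin x fun u => ∀ A ∈ J u, ‖A‖ < M).2 hM⟩

theorem IsConservativeJacobianOn.isUsco_univ [FiniteDimensional ℝ E] [FiniteDimensional ℝ F]
    {f : E → F} {J : E → Set (E →L[ℝ] F)}
    (h : IsConservativeJacobianOn univ f J) : IsUsco J :=
  h.isUsco.comp (g := fun x => (⟨x, mem_univ x⟩ : (univ : Set E))) (by fun_prop)

theorem IsConservativeJacobianOn.of_isUsco {U : Set E} {f : E → F} {J : E → Set (E →L[ℝ] F)}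
    (hf : LocallyLipschitzOn U f) (hne : ∀ x ∈ U, (J x).Nonempty) (hJ : IsUsco fun x : U => J x)
    (hch : ∀ γ : ℝ → E, IsAbsolutelyContinuousCurve γ → (∀ t, γ t ∈ U) →
      ∀ᵐ t : ℝ, ∀ A ∈ J (γ t), HasDerivAt (f ∘ γ) (A (deriv γ t)) t) :
    IsConservativeJacobianOn U f J where
  locallyLipschitzOn := hf
  nonempty := hne
  isClosed_graph := hJ.isClosed_graph
  locallyBounded x hx := by
    obtain ⟨M, hM⟩ := hJ.locallyBounded ⟨x, hx⟩
    exact ⟨M, (eventually_nhds_subtype_iff_nhdsWithin (⟨x, hx⟩ : U)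
      fun u => ∀ A ∈ J u, ‖A‖ < M).1 hM⟩
  chain_rule := hch

theorem LocallyLipschitzOn.comp_mapsTo {X Y Z : Type*} [PseudoEMetricSpace X]
    [PseudoEMetricSpace Y] [PseudoEMetricSpace Z] {U : Set X} {V : Set Y} {g : Y → Z} {f : X → Y}
    (hg : LocallyLipschitzOn V g) (hf : LocallyLipschitzOn U f) (h : MapsTo f U V) :
    LocallyLipschitzOn U (g ∘ f) := by
  intro x hx
  obtain ⟨K, s, hs, hK⟩ := hf hx
  obtain ⟨K', s', hs', hK'⟩ := hg (h hx)
  have hc : Tendsto f (𝓝[U] x) (𝓝[V] f x) :=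
    (hf.continuousOn x hx).tendsto_nhdsWithin h
  refine ⟨K' * K, s ∩ f ⁻¹' s', inter_mem hs (hc hs'), ?_⟩
  exact hK'.comp (hK.mono inter_subset_left) fun y hy => hy.2

/-- The chain rule for conservative Jacobians. -/
theorem IsConservativeJacobianOn.comp [FiniteDimensional ℝ E] [FiniteDimensional ℝ F]
    [FiniteDimensional ℝ G] {U : Set E} {V : Set F} {f : E → F} {g : F → G}
    {J : E → Set (E →L[ℝ] F)} {J' : F → Set (F →L[ℝ] G)}
    (hg : IsConservativeJacobianOn V g J') (hf : IsConservativeJacobianOn U f J)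
    (h : MapsTo f U V) :
    IsConservativeJacobianOn U (g ∘ f)
      fun x => {L | ∃ S ∈ J' (f x), ∃ T ∈ J x, L = S.comp T} := by
  refine .of_isUsco (hg.locallyLipschitzOn.comp_mapsTo hf.locallyLipschitzOn h) ?_ ?_ ?_
  · intro x hx
    obtain ⟨S, hS⟩ := hg.nonempty _ (h hx)
    obtain ⟨T, hT⟩ := hf.nonempty x hx
    exact ⟨_, S, hS, T, hT, rfl⟩
  · have hc : Continuous fun x : U => (⟨f x, h x.2⟩ : V) :=
      (continuousOn_iff_continuous_domRestrict.1 hf.locallyLipschitzOn.continuousOn).subtype_mk _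
    have := ((hg.isUsco.comp hc).prod hf.isUsco).image
      (g := fun p : U × ((F →L[ℝ] G) × (E →L[ℝ] F)) => p.2.1.comp p.2.2)
      (fun x A _ => by fun_prop)
    convert this using 2 with x
    ext L
    constructor
    · rintro ⟨S, hS, T, hT, rfl⟩
      exact ⟨(S, T), ⟨hS, hT⟩, rfl⟩
    · rintro ⟨⟨S, T⟩, ⟨hS, hT⟩, rfl⟩
      exact ⟨S, hS, T, hT, rfl⟩
  · intro γ hγ hU
    filter_upwards [hf.chain_rule γ hγ hU, hg.chain_rule (f ∘ γ)
      (hγ.locallyLipschitzOn_comp hf.locallyLipschitzOn hU) (fun t => h (hU t))] with t h1 h2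
    rintro _ ⟨S, hS, T, hT, rfl⟩
    have h3 := h2 S hS
    rw [(h1 T hT).deriv] at h3
    exact h3

open scoped Pointwise in
/-- Mean value estimate for a map with a convex-valued conservative Jacobian. -/
theorem IsConservativeJacobianOn.eventually_exists_norm_sub_le [FiniteDimensional ℝ E]
    [FiniteDimensional ℝ F] {f : E → F} {J : E → Set (E →L[ℝ] F)}
    (h : IsConservativeJacobianOn univ f J) {p₀ : E} (hconv : Convex ℝ (J p₀)) {ε : ℝ}
    (hε : 0 < ε) : ∀ᶠ q : E × E in 𝓝 (p₀, p₀),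
      ∃ B ∈ J p₀, ‖f q.2 - f q.1 - B (q.2 - q.1)‖ ≤ ε * ‖q.2 - q.1‖ := by
  have : CompleteSpace F := FiniteDimensional.complete ℝ F
  have hev := h.isUsco_univ.eventually_subset p₀ _ (Metric.isOpen_thickening (δ := ε))
    (Metric.self_subset_thickening hε _)
  obtain ⟨r, hr, hball⟩ := Metric.eventually_nhds_iff_ball.1 hev
  filter_upwards [prod_mem_nhds (Metric.ball_mem_nhds p₀ hr) (Metric.ball_mem_nhds p₀ hr)]
  rintro ⟨p, q⟩ ⟨hp, hq⟩
  set d := q - p with hd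
  -- Along the segment, the derivative of `f` lies in this closed convex set, hence so does its mean
  -- over `(0, 1]`, which is `f q - f p`.
  let S : Set F := (fun B : E →L[ℝ] F => B d) '' J p₀ + Metric.closedBall (0 : F) (ε * ‖d‖)
  have hSconv : Convex ℝ S :=
    (hconv.linear_image (ContinuousLinearMap.apply ℝ F d).toLinearMap).add
      (convex_closedBall _ _)
  have hScl : IsClosed S := by
    have : ProperSpace F := FiniteDimensional.proper ℝ _
    refine (IsCompact.add ?_ (isCompact_closedBall _ _)).isClosed
    exact (h.isUsco_univ.isCompact p₀).image (by fun_prop)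
  let γ : ℝ → E := fun t => p + t • d
  have hγ : IsAbsolutelyContinuousCurve γ := isAbsolutelyContinuousCurve_line p d
  have hγd : ∀ t, deriv γ t = d := fun t => by
    have : HasDerivAt γ ((1 : ℝ) • d) t := ((hasDerivAt_id t).smul_const d).const_add p
    simpa using this.deriv
  have hfγ := hγ.locallyLipschitzOn_comp h.locallyLipschitzOn (fun _ => mem_univ _)
  have hint := hfγ.eq_integral 1
  have e0 : (f ∘ γ) 0 = f p := by simp [γ]
  have e1 : (f ∘ γ) 1 = f q := by simp [γ, d]
  rw [e0, e1, intervalIntegral.integral_of_le zero_le_one] at hint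
  have hmem : ∫ t in Ioc (0 : ℝ) 1, deriv (f ∘ γ) t ∈ S := by
    have : IsProbabilityMeasure (volume.restrict (Ioc (0 : ℝ) 1)) := ⟨by simp⟩
    refine hSconv.integral_mem hScl ?_ (hfγ.intervalIntegrable 0 1).1
    filter_upwards [ae_restrict_of_ae (h.chain_rule γ hγ fun _ => mem_univ _),
      ae_restrict_mem measurableSet_Ioc] with t ht htI
    obtain ⟨A, hA⟩ := h.nonempty (γ t) (mem_univ _)
    rw [(ht A hA).deriv, hγd]
    have hγt : γ t ∈ Metric.ball p₀ r := by
      have := (convex_ball p₀ r).add_smul_sub_mem hp hq ⟨htI.1.le, htI.2⟩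
      exact this
    obtain ⟨B, hB, hAB⟩ := Metric.mem_thickening_iff.1 (hball _ hγt hA)
    refine ⟨B d, ⟨B, hB, rfl⟩, (A - B) d, ?_, by simp⟩
    rw [mem_closedBall_zero_iff]
    refine (ContinuousLinearMap.le_opNorm _ _).trans ?_
    rw [dist_eq_norm] at hAB
    gcongr
  rw [← hint] at hmem
  obtain ⟨_, ⟨B, hB, rfl⟩, e, he, hsum⟩ := hmem
  refine ⟨B, hB, ?_⟩
  rw [mem_closedBall_zero_iff] at he
  have : f q - f p - B d = e := by rw [← hsum]; simp
  change ‖f q - f p - B d‖ ≤ _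
  rwa [this]

end ConservativeJacobian

/-! ### The implicit function theorem -/

section ImplicitFunction

variable {E P : Type*} [NormedAddCommGroup E] [NormedSpace ℝ E] [FiniteDimensional ℝ E]
  [NormedAddCommGroup P] [NormedSpace ℝ P] [FiniteDimensional ℝ P]

/-- Reflexivity in finite dimension: it turns a functional separating sets of linear forms into a
direction in `E`. -/
theorem exists_eval_eq_of_finiteDimensional (Φ : (E →L[ℝ] ℝ) →L[ℝ] ℝ) :
    ∃ d : E, ∀ L : E →L[ℝ] ℝ, Φ L = L d := by
  let Ψ : Module.Dual ℝ (Module.Dual ℝ E) :=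
    Φ.toLinearMap.comp (LinearMap.toContinuousLinearMap (𝕜 := ℝ) (E := E) (F' := ℝ)).toLinearMap
  refine ⟨(Module.evalEquiv ℝ E).symm Ψ, fun L => ?_⟩
  have h := Module.apply_evalEquiv_symm_apply ℝ E L.toLinearMap Ψ
  exact h.symm

/-- If all elements of a compact convex set of generalized derivatives of `f` at `z` are
surjective, then `‖f‖` has a local minimum at `z` only if `f z = 0`. -/
theorem eq_zero_of_isLocalMin_norm {H : Type*} [NormedAddCommGroup H] [InnerProductSpace ℝ H]
    {f : E → H} {z : E} {𝒰 : Set (E →L[ℝ] H)} (hc : IsCompact 𝒰) (hconv : Convex ℝ 𝒰)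
    (hsurj : ∀ U ∈ 𝒰, Function.Surjective U)
    (hf : ∀ ε > 0, ∀ᶠ z' in 𝓝 z, ∃ U ∈ 𝒰, ‖f z' - f z - U (z' - z)‖ ≤ ε * ‖z' - z‖)
    (hmin : IsLocalMin (fun z => ‖f z‖) z) : f z = 0 := by
  by_contra hy
  set y := f z with hydef
  let S : Set (E →L[ℝ] ℝ) := (fun U => (innerSL ℝ y).comp U) '' 𝒰
  have hScl : IsClosed S := (hc.image (by fun_prop)).isClosed
  have hSconv : Convex ℝ S :=
    hconv.linear_image (ContinuousLinearMap.compL ℝ E H ℝ (innerSL ℝ y)).toLinearMap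
  have h0 : (0 : E →L[ℝ] ℝ) ∉ S := by
    rintro ⟨U, hU, h⟩
    obtain ⟨x, hx⟩ := hsurj U hU y
    have h' : ⟪y, U x⟫_ℝ = 0 := congrArg (fun L : E →L[ℝ] ℝ => L x) h
    rw [hx, inner_self_eq_zero] at h'
    exact hy h'
  -- Since `0` is separated from `S`, one direction `d` satisfies `⟪y, U d⟫ < u < 0` for all `U` at
  -- once: a uniform descent direction.
  obtain ⟨Φ, u, hΦ, hu⟩ := geometric_hahn_banach_closed_point hSconv hScl h0
  rw [map_zero] at hu
  obtain ⟨d, hd⟩ := exists_eval_eq_of_finiteDimensional Φ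
  have hdesc : ∀ U ∈ 𝒰, ⟪y, U d⟫_ℝ < u := fun U hU => by
    have := hΦ _ ⟨U, hU, rfl⟩
    rw [hd] at this
    exact this
  obtain ⟨C, hC⟩ := hc.isBounded.exists_norm_le
  have hc0 : 0 < ‖y‖ * ‖d‖ + 1 := by positivity
  -- With this `ε` the linearization error costs at most half of the descent rate `-u`; the `+ 1`
  -- keeps the denominator positive.
  set ε := -u / (2 * (‖y‖ * ‖d‖ + 1)) with hε
  have hεpos : 0 < ε := div_pos (by linarith) (by positivity)
  have hεu : ε * (‖y‖ * ‖d‖ + 1) = -u / 2 := by rw [hε]; field_simp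
  -- `K` bounds `‖f(z + t d) - f z‖ / t`. Once `t K² < -u`, the linear decrease `t u` of the squared
  -- norm beats the quadratic term, contradicting minimality.
  set K := (C + ε) * ‖d‖ with hK
  have hlim : Tendsto (fun t : ℝ => z + t • d) (𝓝[>] 0) (𝓝 z) := by
    have : Continuous fun t : ℝ => z + t • d := by fun_prop
    simpa using (this.tendsto 0).mono_left nhdsWithin_le_nhds
  have hsmall : ∀ᶠ t : ℝ in 𝓝[>] 0, t * K ^ 2 < -u := by
    have : Continuous fun t : ℝ => t * K ^ 2 := by fun_prop
    refine ((this.tendsto 0).mono_left nhdsWithin_le_nhds).eventually_lt_const ?_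
    simpa using hu
  obtain ⟨t, ⟨⟨U, hU, hUe⟩, hmint⟩, htK, ht⟩ :=
    (((hlim.eventually (hf ε hεpos)).and (hlim.eventually hmin)).and
      (hsmall.and self_mem_nhdsWithin)).exists
  replace ht : 0 < t := ht
  rw [add_sub_cancel_left, map_smul, norm_smul, Real.norm_of_nonneg ht.le] at hUe
  set g := f (z + t • d) - y with hg
  have hfg : f (z + t • d) = y + g := by rw [hg]; abel
  have hgn : ‖g‖ ≤ t * K := by
    have h1 : ‖g‖ ≤ ‖g - t • U d‖ + ‖t • U d‖ := by
      simpa using norm_add_le (g - t • U d) (t • U d)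
    rw [norm_smul, Real.norm_of_nonneg ht.le] at h1
    have h2 : ‖U d‖ ≤ C * ‖d‖ := (U.le_opNorm d).trans (by gcongr; exact hC U hU)
    have h3 : t * ‖U d‖ ≤ t * (C * ‖d‖) := by gcongr
    have h4 : t * K = t * (C * ‖d‖) + ε * (t * ‖d‖) := by rw [hK]; ring
    linarith
  have hinner : ⟪y, g⟫_ℝ ≤ t * (u / 2) := by
    have h1 : ⟪y, g⟫_ℝ = ⟪y, g - t • U d⟫_ℝ + t * ⟪y, U d⟫_ℝ := by
      have h : g = (g - t • U d) + t • U d := by abel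
      exact (congrArg (inner ℝ y) h).trans (by rw [inner_add_right, real_inner_smul_right])
    have h2 : ⟪y, g - t • U d⟫_ℝ ≤ ‖y‖ * (ε * (t * ‖d‖)) :=
      (real_inner_le_norm _ _).trans (by gcongr)
    have h3 : t * ⟪y, U d⟫_ℝ ≤ t * u := by
      have := (hdesc U hU).le
      gcongr
    have h4 : t * (ε * (‖y‖ * ‖d‖ + 1)) = t * (-u / 2) := by rw [hεu]
    have h5 : 0 < t * ε := by positivity
    nlinarith
  have hsq : ‖y + g‖ ^ 2 = ‖y‖ ^ 2 + 2 * ⟪y, g⟫_ℝ + ‖g‖ ^ 2 := norm_add_sq_real y g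
  have hg2 : ‖g‖ ^ 2 ≤ (t * K) ^ 2 := by gcongr
  have h6 : (t * K) ^ 2 < t * -u := by
    calc (t * K) ^ 2 = t * (t * K ^ 2) := by ring
      _ < t * -u := by gcongr
  have h7 : ‖y‖ ^ 2 ≤ ‖y + g‖ ^ 2 := by
    rw [← hfg]
    gcongr
  linarith

/-- Inversion is continuous at invertible maps, so the inverses form a compact, hence bounded, set.
-/
theorem IsCompact.exists_norm_le_mul_norm_apply {𝒰 : Set (E →L[ℝ] E)} (hc : IsCompact 𝒰)
    (hinv : ∀ U ∈ 𝒰, U.IsInvertible) : ∃ C > 0, ∀ U ∈ 𝒰, ∀ z, ‖z‖ ≤ C * ‖U z‖ := by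
  have : CompleteSpace E := FiniteDimensional.complete ℝ E
  have hcont : ContinuousOn (fun U : E →L[ℝ] E => U.inverse) 𝒰 := fun U hU =>
    ((hinv U hU).contDiffAt_map_inverse (n := 0)).continuousAt.continuousWithinAt
  obtain ⟨C, hC0, hC⟩ := (hc.image_of_continuousOn hcont).isBounded.exists_pos_norm_le
  refine ⟨C, hC0, fun U hU z => ?_⟩
  calc ‖z‖ = ‖U.inverse (U z)‖ := by rw [(hinv U hU).inverse_apply_self]
    _ ≤ ‖U.inverse‖ * ‖U z‖ := U.inverse.le_opNorm _
    _ ≤ C * ‖U z‖ := by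
      gcongr
      exact hC _ ⟨U, hU, rfl⟩

omit [FiniteDimensional ℝ P] in
theorem isOpen_setOf_isInvertible_comp_inl :
    IsOpen {B : E × P →L[ℝ] E | (B.comp (ContinuousLinearMap.inl ℝ E P)).IsInvertible} := by
  have : CompleteSpace E := FiniteDimensional.complete ℝ E
  have h : IsOpen (range ((↑) : (E ≃L[ℝ] E) → E →L[ℝ] E)) := ContinuousLinearEquiv.isOpen
  exact h.preimage (f := fun B : E × P →L[ℝ] E => B.comp (ContinuousLinearMap.inl ℝ E P))
    (by fun_prop)

variable {N : E × P → E} {J : E × P → Set (E × P →L[ℝ] E)} {W : Set P} {ν : P → E}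

/-- On a small sphere around `ν w₀`, `N(·, w₀)` does not vanish, so for `w` near `w₀` the norm of
`N(·, w)` is larger there than at the centre. Its minimum over the ball is therefore interior, hence
a zero, and by uniqueness this zero is `ν w`. -/
theorem IsConservativeJacobianOn.continuousAt_implicit
    (hN : IsConservativeJacobianOn univ N J) (hconv : ∀ p, Convex ℝ (J p)) (hW : IsOpen W)
    (hν : ∀ w ∈ W, ∀ z, N (z, w) = 0 ↔ z = ν w)
    (hU : ∀ w ∈ W, ∀ B ∈ J (ν w, w), (B.comp (ContinuousLinearMap.inl ℝ E P)).IsInvertible)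
    {w₀ : P} (hw₀ : w₀ ∈ W) : ContinuousAt ν w₀ := by
  have hNc : Continuous N := by
    have := hN.locallyLipschitzOn.continuousOn
    rwa [continuousOn_univ] at this
  -- The descent argument needs an inner product on the target, which the norm of `E` need not
  -- provide.
  let e : E ≃L[ℝ] _ := toEuclidean (E := E)
  have hinv : ∀ᶠ p in 𝓝 (ν w₀, w₀), ∀ B ∈ J p,
      (B.comp (ContinuousLinearMap.inl ℝ E P)).IsInvertible :=
    hN.isUsco_univ.eventually_subset _ _ isOpen_setOf_isInvertible_comp_inl (hU w₀ hw₀)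
  rw [nhds_prod_eq] at hinv
  obtain ⟨p₁, hp₁, p₂, hp₂, hinv⟩ := eventually_prod_iff.1 hinv
  obtain ⟨r₀, hr₀, hball⟩ := Metric.eventually_nhds_iff_ball.1 hp₁
  refine Metric.continuousAt_iff'.2 fun r hr => ?_
  -- The bound by `r₀` keeps the minimizer where the blocks `U` are still invertible.
  set ρ := min r r₀ with hρ
  have hρ0 : 0 < ρ := lt_min hr hr₀
  have hcent : N (ν w₀, w₀) = 0 := (hν w₀ hw₀ _).2 rfl
  have hsphere : ∀ᶠ w in 𝓝 w₀, ∀ z ∈ Metric.sphere (ν w₀) ρ,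
      ‖e (N (ν w₀, w))‖ < ‖e (N (z, w))‖ := by
    have : ProperSpace E := FiniteDimensional.proper ℝ _
    refine (isCompact_sphere (ν w₀) ρ).eventually_forall_of_forall_eventually fun z hz => ?_
    have h1 : Continuous fun q : P × E => ‖e (N (ν w₀, q.1))‖ := by fun_prop
    have h2 : Continuous fun q : P × E => ‖e (N (q.2, q.1))‖ := by fun_prop
    refine (h1.continuousAt).eventually_lt (h2.continuousAt) ?_
    change ‖e (N (ν w₀, w₀))‖ < ‖e (N (z, w₀))‖
    rw [hcent, map_zero, norm_zero, norm_pos_iff]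
    refine (map_ne_zero_iff e e.injective).2 fun h => ?_
    have := (hν w₀ hw₀ z).1 h
    rw [this, Metric.mem_sphere, dist_self] at hz
    exact hρ0.ne hz
  filter_upwards [hsphere, hp₂, hW.mem_nhds hw₀] with w hs hw2 hwW
  have : ProperSpace E := FiniteDimensional.proper ℝ _
  have hcont : Continuous fun z => ‖e (N (z, w))‖ := by fun_prop
  obtain ⟨z, hz, hzmin⟩ := (isCompact_closedBall (ν w₀) ρ).exists_isMinOn
    ⟨ν w₀, Metric.mem_closedBall_self hρ0.le⟩ hcont.continuousOn
  have hzball : z ∈ Metric.ball (ν w₀) ρ := by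
    rcases (Metric.mem_closedBall.1 hz).lt_or_eq with h | h
    · exact h
    · exact absurd (hzmin (Metric.mem_closedBall_self hρ0.le)) (not_le.2 (hs z h))
  have hloc : IsLocalMin (fun z => ‖e (N (z, w))‖) z :=
    hzmin.isLocalMin (mem_of_superset (Metric.isOpen_ball.mem_nhds hzball)
      Metric.ball_subset_closedBall)
  let eL : E →L[ℝ] EuclideanSpace ℝ (Fin (Module.finrank ℝ E)) := e
  -- `T B = e ∘ U`, with `U` the block of `B`. It is linear and continuous, so it preserves
  -- compactness and convexity of the Jacobian.
  let T : (E × P →L[ℝ] E) →L[ℝ] (E →L[ℝ] EuclideanSpace ℝ (Fin (Module.finrank ℝ E))) :=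
    (ContinuousLinearMap.compL ℝ E E _ eL).comp
      ((ContinuousLinearMap.compL ℝ E (E × P) E).flip (ContinuousLinearMap.inl ℝ E P))
  have hzero : e (N (z, w)) = 0 := by
    refine eq_zero_of_isLocalMin_norm (f := fun z => e (N (z, w))) (𝒰 := T '' J (z, w))
      ((hN.isUsco_univ.isCompact _).image T.continuous) ((hconv _).linear_image T.toLinearMap)
      ?_ ?_ hloc
    · rintro _ ⟨B, hB, rfl⟩
      have := hinv (hball z (Metric.ball_subset_ball (min_le_right _ _) hzball)) hw2 B hB
      exact e.surjective.comp this.surjective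
    · intro ε hε
      have hε' : 0 < ε / (‖eL‖ + 1) := by positivity
      have h1 := hN.eventually_exists_norm_sub_le (hconv (z, w)) hε'
      have h2 : Tendsto (fun z' : E => ((z, w), (z', w))) (𝓝 z) (𝓝 ((z, w), (z, w))) :=
        Continuous.tendsto (f := fun z' : E => ((z, w), (z', w))) (by fun_prop) z
      filter_upwards [h2.eventually h1] with z' hz'
      obtain ⟨B, hB, hle⟩ := hz'
      refine ⟨T B, ⟨B, hB, rfl⟩, ?_⟩
      have e1 : ((z', w) : E × P) - (z, w) = (z' - z, 0) := by simp
      have e2 : ‖((z' - z, 0) : E × P)‖ = ‖z' - z‖ := by simp [Prod.norm_def]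
      change ‖N (z', w) - N (z, w) - B ((z', w) - (z, w))‖ ≤ _ * ‖((z', w) : E × P) - (z, w)‖ at hle
      rw [e1, e2] at hle
      have e3 : e (N (z', w)) - e (N (z, w)) - T B (z' - z) =
          eL (N (z', w) - N (z, w) - B (z' - z, 0)) := by
        simp [T, eL]
      rw [e3]
      calc _ ≤ ‖eL‖ * (ε / (‖eL‖ + 1) * ‖z' - z‖) :=
            (eL.le_opNorm _).trans (by gcongr)
        _ ≤ (‖eL‖ + 1) * (ε / (‖eL‖ + 1) * ‖z' - z‖) := by
            gcongr
            linarith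
        _ = ε * ‖z' - z‖ := by field_simp
  rw [map_eq_zero_iff e e.injective, hν w hwW] at hzero
  rw [← hzero]
  exact Metric.mem_ball.1 (Metric.ball_subset_ball (min_le_left _ _) hzball)

theorem IsConservativeJacobianOn.locallyLipschitzOn_implicit
    (hN : IsConservativeJacobianOn univ N J) (hconv : ∀ p, Convex ℝ (J p)) (hW : IsOpen W)
    (hν : ∀ w ∈ W, ∀ z, N (z, w) = 0 ↔ z = ν w)
    (hU : ∀ w ∈ W, ∀ B ∈ J (ν w, w), (B.comp (ContinuousLinearMap.inl ℝ E P)).IsInvertible) :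
    LocallyLipschitzOn W ν := by
  intro w₀ hw₀
  have hJc := hN.isUsco_univ.isCompact (ν w₀, w₀)
  obtain ⟨C₁, hC₁, hlow⟩ := IsCompact.exists_norm_le_mul_norm_apply
    (hJc.image (f := fun B : E × P →L[ℝ] E => B.comp (ContinuousLinearMap.inl ℝ E P))
      (by fun_prop)) (by rintro _ ⟨B, hB, rfl⟩; exact hU w₀ hw₀ B hB)
  obtain ⟨C₂, hC₂, hup⟩ := hJc.isBounded.exists_pos_norm_le
  -- After multiplication by `C₁`, the error is `(‖x‖ + ‖y‖) / 2`. Half of `‖x‖` is absorbed on the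
  -- left, leaving the Lipschitz constant `2 C₁ C₂ + 1`.
  have hε : 0 < 1 / (2 * C₁) := by positivity
  have hev := hN.eventually_exists_norm_sub_le (hconv (ν w₀, w₀)) hε
  have hνc := hN.continuousAt_implicit hconv hW hν hU hw₀
  have hgr : Tendsto (fun w => (ν w, w)) (𝓝 w₀) (𝓝 (ν w₀, w₀)) := hνc.prodMk continuousAt_id
  rw [nhds_prod_eq] at hev
  have hev' := (hgr.prodMap hgr).eventually hev
  obtain ⟨s, hs, hsub⟩ := Filter.eventually_prod_self_iff'.1 hev'
  refine ⟨(2 * C₁ * C₂ + 1).toNNReal, s ∩ W,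
    mem_nhdsWithin_of_mem_nhds (inter_mem hs (hW.mem_nhds hw₀)), ?_⟩
  refine LipschitzOnWith.of_dist_le_mul fun w' hw' w hw => ?_
  rw [Real.coe_toNNReal _ (by positivity), dist_eq_norm, dist_eq_norm]
  obtain ⟨B, hB, hle⟩ := hsub w hw.1 w' hw'.1
  change ‖N (ν w', w') - N (ν w, w) - B ((ν w', w') - (ν w, w))‖ ≤
    1 / (2 * C₁) * ‖((ν w', w') : E × P) - (ν w, w)‖ at hle
  rw [(hν w' hw'.2 _).2 rfl, (hν w hw.2 _).2 rfl, sub_self, zero_sub, norm_neg,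
    Prod.mk_sub_mk] at hle
  set x := ν w' - ν w
  set y := w' - w
  have h1 : ‖((x, y) : E × P)‖ ≤ ‖x‖ + ‖y‖ :=
    max_le (by linarith [norm_nonneg y]) (by linarith [norm_nonneg x])
  have h2 : ‖x‖ ≤ C₁ * ‖B (x, 0)‖ := hlow _ ⟨B, hB, rfl⟩ x
  have h3 : B (x, 0) = B (x, y) - B (0, y) := by rw [← map_sub]; simp
  have h4 : ‖B (0, y)‖ ≤ C₂ * ‖y‖ := by
    refine (B.le_opNorm _).trans ?_
    have : ‖((0, y) : E × P)‖ = ‖y‖ := by simp [Prod.norm_def]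
    rw [this]
    gcongr
    exact hup B hB
  have h5 : ‖B (x, 0)‖ ≤ 1 / (2 * C₁) * (‖x‖ + ‖y‖) + C₂ * ‖y‖ := by
    rw [h3]
    refine (norm_sub_le _ _).trans (add_le_add (hle.trans ?_) h4)
    gcongr
  have h6 : ‖x‖ ≤ (‖x‖ + ‖y‖) / 2 + C₁ * C₂ * ‖y‖ := by
    calc ‖x‖ ≤ C₁ * (1 / (2 * C₁) * (‖x‖ + ‖y‖) + C₂ * ‖y‖) := h2.trans (by gcongr)
      _ = (‖x‖ + ‖y‖) / 2 + C₁ * C₂ * ‖y‖ := by field_simp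
  linarith

/-- The implicit function theorem for convex-valued conservative Jacobians. -/
theorem IsConservativeJacobianOn.implicit
    (hN : IsConservativeJacobianOn univ N J) (hconv : ∀ p, Convex ℝ (J p)) (hW : IsOpen W)
    (hν : ∀ w ∈ W, ∀ z, N (z, w) = 0 ↔ z = ν w)
    (hU : ∀ w ∈ W, ∀ B ∈ J (ν w, w), (B.comp (ContinuousLinearMap.inl ℝ E P)).IsInvertible) :
    IsConservativeJacobianOn W ν fun w => {L | ∃ B ∈ J (ν w, w),
      L = -((B.comp (ContinuousLinearMap.inl ℝ E P)).inverse.comp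
        (B.comp (ContinuousLinearMap.inr ℝ E P)))} := by
  have : CompleteSpace E := FiniteDimensional.complete ℝ E
  have hlip := hN.locallyLipschitzOn_implicit hconv hW hν hU
  refine .of_isUsco hlip ?_ ?_ ?_
  · intro w _
    obtain ⟨B, hB⟩ := hN.nonempty (ν w, w) (mem_univ _)
    exact ⟨_, B, hB, rfl⟩
  · have hc : Continuous fun w : W => ((ν w, w) : E × P) :=
      (continuousOn_iff_continuous_domRestrict.1 hlip.continuousOn).prodMk continuous_subtype_val
    have := (hN.isUsco_univ.comp hc).image
      (g := fun p : W × (E × P →L[ℝ] E) =>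
        -((p.2.comp (ContinuousLinearMap.inl ℝ E P)).inverse.comp
          (p.2.comp (ContinuousLinearMap.inr ℝ E P))))
      (fun w B hB => by
        have h1 : ContinuousAt (fun p : W × (E × P →L[ℝ] E) =>
            (p.2.comp (ContinuousLinearMap.inl ℝ E P)).inverse) (w, B) :=
          ContinuousAt.comp (g := ContinuousLinearMap.inverse)
            ((hU w w.2 B hB).contDiffAt_map_inverse (n := 0)).continuousAt (by fun_prop)
        exact (h1.clm_comp (by fun_prop)).neg)
    convert this using 2 with w
    ext L
    exact ⟨fun ⟨B, hB, h⟩ => ⟨B, hB, h.symm⟩, fun ⟨B, hB, h⟩ => ⟨B, hB, h.symm⟩⟩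
  · intro γ hγ hγW
    have hνγ := hγ.locallyLipschitzOn_comp hlip hγW
    have hzero : N ∘ (fun t => ((ν ∘ γ) t, γ t)) = fun _ => 0 :=
      funext fun t => (hν _ (hγW t) _).2 rfl
    filter_upwards [hN.chain_rule _ (hνγ.prodMk hγ) (fun _ => mem_univ _),
      hνγ.ae_differentiableAt, hγ.ae_differentiableAt] with t ht hd1 hd2
    rintro _ ⟨B, hB, rfl⟩
    have h1 := ht B hB
    rw [hzero, (hd1.hasDerivAt.prodMk hd2.hasDerivAt).deriv] at h1
    -- The residual is constant along the lifted curve, so `B` annihilates its velocity.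
    have h2 := h1.unique (hasDerivAt_const t (0 : E))
    have h3 : (B.comp (ContinuousLinearMap.inl ℝ E P)) (deriv (ν ∘ γ) t) =
        -(B.comp (ContinuousLinearMap.inr ℝ E P)) (deriv γ t) := by
      rw [eq_neg_iff_add_eq_zero, ← h2]
      simp only [ContinuousLinearMap.comp_apply, ← map_add]
      simp
    have h4 : deriv (ν ∘ γ) t = -((B.comp (ContinuousLinearMap.inl ℝ E P)).inverse.comp
        (B.comp (ContinuousLinearMap.inr ℝ E P))) (deriv γ t) := by
      rw [← (hU _ (hγW t) B hB).inverse_apply_self (deriv (ν ∘ γ) t), h3, map_neg]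
      rfl
    rw [neg_apply, ← h4]
    exact hd1.hasDerivAt

end ImplicitFunction

/-! ### Cone programs: duality and the residual map -/

section ConeProgram

variable {n m : ℕ}

theorem IsNearestPoint.real_inner_le_zero {E : Type*} [NormedAddCommGroup E]
    [InnerProductSpace ℝ E] {C : Set E} (hC : Convex ℝ C) {x p : E} (h : IsNearestPoint C x p) :
    ∀ q ∈ C, ⟪x - p, q - p⟫_ℝ ≤ 0 := by
  refine (norm_eq_iInf_iff_real_inner_le_zero hC h.1).1 ?_
  have : Nonempty C := ⟨⟨p, h.1⟩⟩
  refine le_antisymm (le_ciInf fun q => ?_)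
    (ciInf_le ⟨0, by rintro _ ⟨y, rfl⟩; exact norm_nonneg _⟩ (⟨p, h.1⟩ : C))
  rw [norm_sub_rev x p, norm_sub_rev x q]
  exact h.2 q q.2

/-- Moreau's characterization of the projection onto the dual cone. -/
theorem projDual_eq_iff (K : ProperCone ℝ (Euc m)) (v p : Euc m) :
    projDual K v = p ↔ p ∈ dualCone K ∧ p - v ∈ K ∧ ⟪p - v, p⟫_ℝ = 0 := by
  constructor
  · rintro rfl
    have hnear := isNearestPoint_projDual K v
    set p := projDual K v
    have hp : p ∈ dualCone K := hnear.1
    have hle := hnear.real_inner_le_zero (convex_dualCone K)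
    -- The variational inequality tested at `0` and `2p` gives orthogonality; tested at `p + q` it
    -- puts `p - v` in the bidual cone, which is `K`.
    have h0 : 0 ≤ ⟪v - p, p⟫_ℝ := by
      simpa using hle 0 (dualCone K).zero_mem
    have h2 : ⟪v - p, p⟫_ℝ ≤ 0 := by
      simpa using hle (p + p) (add_mem hp hp)
    refine ⟨hp, ?_, ?_⟩
    · rw [← ProperCone.innerDual_innerDual K, ProperCone.mem_innerDual]
      intro q hq
      have h3 : ⟪v - p, q⟫_ℝ ≤ 0 := by
        simpa using hle (p + q) (add_mem hp hq)
      rw [real_inner_comm, ← neg_sub v p, inner_neg_left]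
      linarith
    · rw [← neg_sub v p, inner_neg_left]
      linarith
  · rintro ⟨hp, hs, h0⟩
    refine (isNearestPoint_projDual K v).eq_of_convex (convex_dualCone K) ⟨hp, fun q hq => ?_⟩
    have hq' : 0 ≤ ⟪p - v, q⟫_ℝ := ProperCone.mem_innerDual.1 hq hs
    have e : q - v = (q - p) + (p - v) := by abel
    have h1 : ‖q - v‖ ^ 2 = ‖q - p‖ ^ 2 + 2 * ⟪q - p, p - v⟫_ℝ + ‖p - v‖ ^ 2 := by
      rw [e, norm_add_sq_real]
    rw [real_inner_comm, inner_sub_right, h0, sub_zero] at h1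
    exact le_of_sq_le_sq (by nlinarith [sq_nonneg ‖q - p‖]) (norm_nonneg _)

theorem inner_mulVecE_transpose (A : Matrix (Fin m) (Fin n) ℝ) (y : Euc m) (x : Euc n) :
    ⟪mulVecE Aᵀ y, x⟫_ℝ = ⟪mulVecE A x, y⟫_ℝ := by
  simp only [mulVecE, EuclideanSpace.inner_eq_star_dotProduct, star_trivial]
  rw [Matrix.mulVec_transpose, dotProduct_comm, ← Matrix.dotProduct_mulVec, dotProduct_comm,
    dotProduct_comm]

/-- The duality gap of a feasible pair. -/
theorem inner_add_inner_eq_of_feasible {K : ProperCone ℝ (Euc m)} {w : Param n m} {x : Euc n}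
    {y s : Euc m} (hP : PrimalFeasible K w x s) (hD : DualFeasible K w y) :
    ⟪w.2.2, x⟫_ℝ + ⟪w.2.1, y⟫_ℝ = ⟪s, y⟫_ℝ := by
  have hc : w.2.2 = -mulVecE w.1ᵀ y := eq_neg_of_add_eq_zero_right hD.1
  rw [hc, ← hP.1, inner_neg_left, inner_add_left, inner_mulVecE_transpose]
  ring

theorem inner_nonneg_of_feasible {K : ProperCone ℝ (Euc m)} {w : Param n m} {x : Euc n}
    {y s : Euc m} (hP : PrimalFeasible K w x s) (hD : DualFeasible K w y) : 0 ≤ ⟪s, y⟫_ℝ :=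
  ProperCone.mem_innerDual.1 hD.2 hP.2

theorem residualMap_eq_zero_iff (K : ProperCone ℝ (Euc m)) (z : Var n m) (w : Param n m) :
    residualMap K (z, w) = 0 ↔
      mulVecE w.1ᵀ (projDual K z.2) + w.2.2 = 0 ∧
        mulVecE w.1 z.1 + (projDual K z.2 - z.2) = w.2.1 := by
  rw [Prod.ext_iff]
  refine and_congr ?_ ?_
  · have : (residualMap K (z, w)).1 = mulVecE w.1ᵀ (projDual K z.2) + w.2.2 := by
      simp only [residualMap, skewQ, projPi, vecV, Prod.fst_add, Prod.fst_sub]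
      abel
    rw [this]
    rfl
  · have : (residualMap K (z, w)).2 =
        w.2.1 - (mulVecE w.1 z.1 + (projDual K z.2 - z.2)) := by
      simp only [residualMap, skewQ, projPi, vecV, Prod.snd_add, Prod.snd_sub]
      abel
    rw [this, Prod.snd_zero, sub_eq_zero, eq_comm]

/-- Zeros of the residual map are the primal-dual solutions with zero duality gap. -/
theorem exists_residualMap_eq_zero_iff (K : ProperCone ℝ (Euc m)) (w : Param n m)
    (t : Sol n m) : (∃ z, residualMap K (z, w) = 0 ∧ phi K z = t) ↔
      PrimalFeasible K w t.1 t.2.2 ∧ DualFeasible K w t.2.1 ∧ ⟪t.2.2, t.2.1⟫_ℝ = 0 := by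
  constructor
  · rintro ⟨z, hz, rfl⟩
    obtain ⟨h1, h2⟩ := (residualMap_eq_zero_iff K z w).1 hz
    obtain ⟨hp, hs, h0⟩ := (projDual_eq_iff K z.2 _).1 rfl
    exact ⟨⟨h2, hs⟩, ⟨h1, hp⟩, h0⟩
  · obtain ⟨x, y, s⟩ := t
    rintro ⟨⟨h2, hs⟩, ⟨h1, hy⟩, h0⟩
    have hP : projDual K (y - s) = y := by
      refine (projDual_eq_iff K _ _).2 ⟨hy, ?_, ?_⟩
      · simpa using hs
      · simpa using h0
    refine ⟨(x, y - s), (residualMap_eq_zero_iff K _ w).2 ?_, ?_⟩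
    · simp only [hP, sub_sub_cancel]
      exact ⟨h1, h2⟩
    · simp [phi, hP]

/-- The zero-gap triple `sol K ν w` is optimal by weak duality. Comparing objectives with it forces
the gap of any other solution to vanish, so that solution also comes from the unique zero. -/
theorem isPrimalDualSolution_iff_eq_sol (K : ProperCone ℝ (Euc m)) {w : Param n m}
    {ν : Param n m → Var n m} (hν : ∀ z : Var n m, residualMap K (z, w) = 0 ↔ z = ν w)
    (t : Sol n m) : IsPrimalDualSolution K w t ↔ t = sol K ν w := by
  obtain ⟨hP₀, hD₀, hgap₀⟩ :=
    (exists_residualMap_eq_zero_iff K w (sol K ν w)).1 ⟨ν w, (hν _).2 rfl, rfl⟩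
  have e₀ := inner_add_inner_eq_of_feasible hP₀ hD₀
  constructor
  · rintro ⟨⟨hP, hPmin⟩, hD, hDmin⟩
    have h1 := hPmin _ _ hP₀
    have h2 := hDmin _ hD₀
    have e := inner_add_inner_eq_of_feasible hP hD
    have h3 := inner_nonneg_of_feasible hP hD
    obtain ⟨z, hz, rfl⟩ := (exists_residualMap_eq_zero_iff K w t).2 ⟨hP, hD, by linarith⟩
    rw [(hν z).1 hz]
    rfl
  · rintro rfl
    refine ⟨⟨hP₀, fun x s h => ?_⟩, hD₀, fun y h => ?_⟩
    · have := inner_add_inner_eq_of_feasible h hD₀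
      have := inner_nonneg_of_feasible h hD₀
      linarith
    · have := inner_add_inner_eq_of_feasible hP₀ h
      have := inner_nonneg_of_feasible hP₀ h
      linarith

/-! ### Conservative Jacobians of `φ` -/

theorem continuous_blockPhi :
    Continuous fun q : (Euc m →L[ℝ] Euc m) × (Euc m →L[ℝ] Euc m) =>
      (blockPhi q.1 q.2 : Var n m →L[ℝ] Sol n m) := by
  have : (fun q : (Euc m →L[ℝ] Euc m) × (Euc m →L[ℝ] Euc m) =>
      (blockPhi q.1 q.2 : Var n m →L[ℝ] Sol n m)) = fun q =>
      (ContinuousLinearMap.inl ℝ (Euc n) (Euc m × Euc m)).comp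
          (ContinuousLinearMap.fst ℝ (Euc n) (Euc m)) +
        (ContinuousLinearMap.inr ℝ (Euc n) (Euc m × Euc m)).comp
          ((ContinuousLinearMap.inl ℝ (Euc m) (Euc m)).comp
              (q.1.comp (ContinuousLinearMap.snd ℝ (Euc n) (Euc m))) +
            (ContinuousLinearMap.inr ℝ (Euc m) (Euc m)).comp
              ((q.2 - ContinuousLinearMap.id ℝ (Euc m)).comp
                (ContinuousLinearMap.snd ℝ (Euc n) (Euc m)))) := by
    funext q
    refine ContinuousLinearMap.ext fun z => ?_
    simp [blockPhi]
  rw [this]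
  fun_prop

variable {K : ProperCone ℝ (Euc m)} {JP : Euc m → Set (Euc m →L[ℝ] Euc m)}

theorem locallyLipschitz_phi (h : LocallyLipschitz (projDual K)) :
    LocallyLipschitz (phi K : Var n m → Sol n m) := by
  have hs : LocallyLipschitz (Prod.snd : Var n m → Euc m) := LipschitzWith.prod_snd.locallyLipschitz
  have hf : LocallyLipschitz (Prod.fst : Var n m → Euc n) := LipschitzWith.prod_fst.locallyLipschitz
  have hp : LocallyLipschitz fun z : Var n m => projDual K z.2 := h.comp hs
  exact hf.prodMk (hp.prodMk (hp.sub hs))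

/-- Outside one null set of times, the chain rule for `P_{K*}` holds for all elements of its
Jacobian, so `M` and `M'` may be chosen independently. -/
theorem ae_hasDerivAt_phi_comp (hJP : IsConservativeJacobianOn univ (projDual K) JP)
    {γ : ℝ → Var n m} (hγ : IsAbsolutelyContinuousCurve γ) :
    ∀ᵐ t : ℝ, ∀ M ∈ JP (γ t).2, ∀ M' ∈ JP (γ t).2,
      HasDerivAt (phi K ∘ γ) (blockPhi M M' (deriv γ t)) t := by
  filter_upwards [hγ.ae_differentiableAt, hJP.chain_rule _
    (hγ.clm_comp (ContinuousLinearMap.snd ℝ (Euc n) (Euc m))) (fun _ => mem_univ _)]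
    with t hd ht M hM M' hM'
  have h1 : HasDerivAt (fun t => (γ t).1) (deriv γ t).1 t :=
    (ContinuousLinearMap.fst ℝ (Euc n) (Euc m)).hasFDerivAt.comp_hasDerivAt t hd.hasDerivAt
  have h2 : HasDerivAt (fun t => (γ t).2) (deriv γ t).2 t :=
    (ContinuousLinearMap.snd ℝ (Euc n) (Euc m)).hasFDerivAt.comp_hasDerivAt t hd.hasDerivAt
  have h3 : ∀ M ∈ JP (γ t).2, HasDerivAt (fun t => projDual K (γ t).2) (M (deriv γ t).2) t := by
    intro M hM
    have := ht M hM
    rw [HasDerivAt.deriv (f := fun t => ContinuousLinearMap.snd ℝ (Euc n) (Euc m) (γ t)) h2]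
      at this
    exact this
  exact h1.prodMk ((h3 M hM).prodMk ((h3 M' hM').sub h2))

theorem isConservativeJacobianOn_jacPhi
    (hJP : IsConservativeJacobianOn univ (projDual K) JP) :
    IsConservativeJacobianOn univ (phi K : Var n m → Sol n m) (jacPhi JP) := by
  refine .of_isUsco (locallyLipschitzOn_univ.2
    (locallyLipschitz_phi (locallyLipschitzOn_univ.1 hJP.locallyLipschitzOn))) ?_ ?_ ?_
  · intro z _
    obtain ⟨M, hM⟩ := hJP.nonempty z.2 (mem_univ _)
    exact ⟨_, M, hM, M, hM, rfl⟩
  · have hc : Continuous fun z : (univ : Set (Var n m)) => z.1.2 := by fun_prop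
    have := ((hJP.isUsco_univ.comp hc).prod (hJP.isUsco_univ.comp hc)).image
      (g := fun p => (blockPhi p.2.1 p.2.2 : Var n m →L[ℝ] Sol n m))
      fun _ _ _ => (continuous_blockPhi.comp continuous_snd).continuousAt
    convert this using 2 with z
    ext L
    exact ⟨fun ⟨M, hM, M', hM', h⟩ => ⟨(M, M'), ⟨hM, hM'⟩, h.symm⟩,
      fun ⟨⟨M, M'⟩, ⟨hM, hM'⟩, h⟩ => ⟨M, hM, M', hM', h.symm⟩⟩
  · intro γ hγ _
    filter_upwards [ae_hasDerivAt_phi_comp hJP hγ] with t ht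
    rintro _ ⟨M, hM, M', hM', rfl⟩
    exact ht M hM M' hM'

theorem isConservativeJacobianOn_jacPhiSame
    (hJP : IsConservativeJacobianOn univ (projDual K) JP) :
    IsConservativeJacobianOn univ (phi K : Var n m → Sol n m) (jacPhiSame JP) := by
  refine .of_isUsco (isConservativeJacobianOn_jacPhi hJP).locallyLipschitzOn ?_ ?_ ?_
  · intro z _
    obtain ⟨M, hM⟩ := hJP.nonempty z.2 (mem_univ _)
    exact ⟨_, M, hM, rfl⟩
  · have hc : Continuous fun z : (univ : Set (Var n m)) => z.1.2 := by fun_prop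
    have := (hJP.isUsco_univ.comp hc).image
      (g := fun p => (blockPhi p.2 p.2 : Var n m →L[ℝ] Sol n m))
      fun _ _ _ => (continuous_blockPhi.comp (continuous_snd.prodMk continuous_snd)).continuousAt
    convert this using 2 with z
    ext L
    exact ⟨fun ⟨M, hM, h⟩ => ⟨M, hM, h.symm⟩, fun ⟨M, hM, h⟩ => ⟨M, hM, h.symm⟩⟩
  · intro γ hγ _
    filter_upwards [ae_hasDerivAt_phi_comp hJP hγ] with t ht
    rintro _ ⟨M, hM, rfl⟩
    exact ht M hM M hM

end ConeProgram

theorem proposition4 (n m : ℕ)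
    -- a nonempty closed convex cone `K ⊆ ℝᵐ`
    (K : ProperCone ℝ (Euc m))
    -- convex-valued conservative Jacobians of `P_{K*}` and of the residual map
    (JP : Euc m → Set (Euc m →L[ℝ] Euc m))
    (hJP : IsConservativeJacobianOn Set.univ (projDual K) JP)
    (hJPconv : ∀ v, Convex ℝ (JP v))
    (JN : Var n m × Param n m → Set (Var n m × Param n m →L[ℝ] Var n m))
    (hJN : IsConservativeJacobianOn Set.univ (residualMap K) JN)
    (hJNconv : ∀ p, Convex ℝ (JN p))
    -- an open set of parameters, on which `ν` is the unique zero of the residual map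
    (W : Set (Param n m)) (hW : IsOpen W)
    (ν : Param n m → Var n m)
    (hν : ∀ w ∈ W, ∀ z : Var n m, residualMap K (z, w) = 0 ↔ z = ν w)
    -- and all the blocks `U` are invertible
    (hU : ∀ w ∈ W, ∀ B ∈ JN (ν w, w), (blockU B).IsInvertible) :
    -- path differentiability
    (PathDifferentiableOn W ν ∧
      PathDifferentiableOn Set.univ (phi K : Var n m → Sol n m) ∧
      PathDifferentiableOn W (sol K ν)) ∧
    -- conservative Jacobians of `ν`, `φ` and `sol`
    IsConservativeJacobianOn W ν (jacNu JN ν) ∧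
    (IsConservativeJacobianOn Set.univ (phi K : Var n m → Sol n m) (jacPhi JP) ∧
      IsConservativeJacobianOn W (sol K ν) (jacComp (jacPhi JP) ν (jacNu JN ν))) ∧
    (IsConservativeJacobianOn Set.univ (phi K : Var n m → Sol n m) (jacPhiSame JP) ∧
      IsConservativeJacobianOn W (sol K ν) (jacComp (jacPhiSame JP) ν (jacNu JN ν))) ∧
    -- `sol` is the primal-dual solution map of (P) and (D)
    (∀ w ∈ W, ∀ t : Sol n m, IsPrimalDualSolution K w t ↔ t = sol K ν w) := by
  have hν' := hJN.implicit hJNconv hW hν hU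
  have hφ := isConservativeJacobianOn_jacPhi (n := n) hJP
  have hφ' := isConservativeJacobianOn_jacPhiSame (n := n) hJP
  have hsol := hφ.comp hν' (mapsTo_univ ν W)
  have hsol' := hφ'.comp hν' (mapsTo_univ ν W)
  exact ⟨⟨⟨_, hν'⟩, ⟨_, hφ⟩, ⟨_, hsol⟩⟩, hν', ⟨hφ, hsol⟩, ⟨hφ', hsol'⟩,
    fun w hw => isPrimalDualSolution_iff_eq_sol K (hν w hw)⟩
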